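/- Let $G$ be a finite nilpotent group, and let $g,h\in G$ be such that $h$ has order $p$, where $p\neq 2$ is a prime number, and $g\notin N_G(\langle h\rangle)$, the normalizer of $\langle h\rangle$ in $G$. Write $\tilde h=\sum_{x\in\langle h\rangle}x\in\mathbb{Z}G$, and for a positive integer $k$ let $$b_k(g,\tilde h)=h^k+(1-h)\,g\,\tilde h ,$$ which is a unit of the integral group ring $\mathbb{Z}G$. Let $*$ denote the classical involution of $\mathbb{Z}G$, that is, the $\mathbb{Z}$-linear map with $x^*=x^{-1}$ for $x\in G$. Then, for all positive integers $k$ and $l$, the subgroup $$\langle\, b_k(g,\tilde h)\,b_l(g,\tilde h)^*,\; b_l(g,\tilde h)^*\,b_k(g,\tilde h)\,\rangle$$ of the unit group $\mathcal{U}(\mathbb{Z}G)$ is a free group of rank $2$. -/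

import Mathlib

noncomputable section

namespace BovdiUnits

variable {G : Type*} [Group G]

/-- The integral group ring `ℤG`. -/
abbrev ZG (G : Type*) := MonoidAlgebra ℤ G

/-- The element of `ℤG` given by a group element. -/
abbrev elt (x : G) : ZG G := MonoidAlgebra.of ℤ G x

/-- For a subset `H` of a finite group, the sum in `ℤG` of the elements of `H`. -/
def tildeSet [Finite G] (H : Set G) : ZG G := ∑ x ∈ H.toFinite.toFinset, elt x

/-- The sum `h̃` in `ℤG` of the elements of the cyclic group `⟨h⟩`. -/
def tilde [Finite G] (h : G) : ZG G := tildeSet (Subgroup.zpowers h : Set G)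

theorem tilde_mul_elt [Finite G] (h : G) : tilde h * elt h = tilde h := by
  unfold tilde tildeSet
  rw [Finset.sum_mul]
  refine Finset.sum_bij' (fun x _ => x * h) (fun x _ => x * h⁻¹) ?_ ?_ ?_ ?_ ?_
  · intro a ha
    simp only [Set.Finite.mem_toFinset, SetLike.mem_coe] at ha ⊢
    exact mul_mem ha (Subgroup.mem_zpowers h)
  · intro a ha
    simp only [Set.Finite.mem_toFinset, SetLike.mem_coe] at ha ⊢
    exact mul_mem ha (inv_mem (Subgroup.mem_zpowers h))
  · intro a _; simp
  · intro a _; simp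
  · intro a _; simp [MonoidAlgebra.single_mul_single]

theorem tilde_mul_elt_pow [Finite G] (h : G) (n : ℕ) :
    tilde h * elt (h ^ n) = tilde h := by
  induction n with
  | zero =>
    have : elt (h ^ 0) = (1 : ZG G) := by rw [pow_zero]; exact map_one _
    rw [this, mul_one]
  | succ n ih =>
    have : elt (h ^ (n + 1)) = elt (h ^ n) * elt h := by rw [pow_succ]; exact map_mul _ _ _
    rw [this, ← mul_assoc, ih, tilde_mul_elt]

theorem tilde_mul_elt_pow_inv [Finite G] (h : G) (n : ℕ) :
    tilde h * elt (h ^ n)⁻¹ = tilde h := by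
  have h1 : elt (h ^ n) * elt (h ^ n)⁻¹ = (1 : ZG G) := by
    rw [elt, elt, ← map_mul, mul_inv_cancel, map_one]
  calc tilde h * elt (h ^ n)⁻¹ = tilde h * elt (h ^ n) * elt (h ^ n)⁻¹ := by
        rw [tilde_mul_elt_pow]
    _ = tilde h := by rw [mul_assoc, h1, mul_one]

theorem tilde_mul_one_sub [Finite G] (h : G) : tilde h * (1 - elt h) = 0 := by
  rw [mul_sub, mul_one, tilde_mul_elt, sub_self]

/-- The Bovdi unit `b_k(g, h̃) = h ^ k + (1 - h) g h̃` of `ℤG`. -/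
def bovdiUnit [Finite G] (k : ℕ) (g h : G) : (ZG G)ˣ where
  val := elt (h ^ k) + (1 - elt h) * elt g * tilde h
  inv := elt (h ^ k)⁻¹ - elt (h ^ k)⁻¹ * ((1 - elt h) * elt g * tilde h)
  val_inv := by
    have h1 : elt (h ^ k) * elt (h ^ k)⁻¹ = (1 : ZG G) := by
      rw [elt, elt, ← map_mul, mul_inv_cancel, map_one]
    have h3 := tilde_mul_elt_pow_inv h k
    have h4 := tilde_mul_one_sub h
    generalize elt (h ^ k) = a at *
    generalize elt (h ^ k)⁻¹ = b at *
    generalize tilde h = t at *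
    generalize 1 - elt h = d at *
    generalize elt g = c at *
    have e1 : d * c * t * b = d * c * t := by rw [mul_assoc, h3]
    have e2 : d * c * t * (d * c * t) = 0 := by
      rw [mul_assoc (d * c) t, ← mul_assoc t, ← mul_assoc t, h4]; simp
    rw [add_mul, mul_sub, mul_sub, ← mul_assoc a, ← mul_assoc (d * c * t) b, h1, e1, e2]
    simp
  inv_val := by
    have h2 : elt (h ^ k)⁻¹ * elt (h ^ k) = (1 : ZG G) := by
      rw [elt, elt, ← map_mul, inv_mul_cancel, map_one]
    have h3 := tilde_mul_elt_pow h k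
    have h4 := tilde_mul_one_sub h
    generalize elt (h ^ k) = a at *
    generalize elt (h ^ k)⁻¹ = b at *
    generalize tilde h = t at *
    generalize 1 - elt h = d at *
    generalize elt g = c at *
    have e1 : d * c * t * a = d * c * t := by rw [mul_assoc, h3]
    have e2 : d * c * t * (d * c * t) = 0 := by
      rw [mul_assoc (d * c) t, ← mul_assoc t, ← mul_assoc t, h4]; simp
    rw [sub_mul, mul_add, mul_add, mul_assoc b, mul_assoc b, h2, e1, e2]
    simp

/-- The classical involution of `ℤG`: the `ℤ`-linear map with `x ↦ x⁻¹` for `x` in `G`. -/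
def involution : ZG G →ₗ[ℤ] ZG G := MonoidAlgebra.mapDomainLinearMap ℤ ℤ (fun x : G => x⁻¹)

theorem involution_elt (x : G) : involution (elt x) = elt x⁻¹ := by
  simp [involution]

theorem involution_one : involution (1 : ZG G) = 1 := by
  have h := involution_elt (1 : G)
  rwa [inv_one, elt, map_one] at h

theorem involution_mul (x y : ZG G) : involution (x * y) = involution y * involution x := by
  induction x using MonoidAlgebra.induction_linear with
  | zero => simp
  | add a b ha hb => rw [add_mul, map_add, ha, hb, map_add, mul_add]
  | single a r =>
    induction y using MonoidAlgebra.induction_linear with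
    | zero => simp
    | add c d hc hd => rw [mul_add, map_add, hc, hd, map_add, add_mul]
    | single c s => simp [involution, MonoidAlgebra.single_mul_single, mul_comm]

/-- The image `u*` of a unit `u` of `ℤG` under the classical involution. -/
def unitStar (u : (ZG G)ˣ) : (ZG G)ˣ where
  val := involution (u : ZG G)
  inv := involution ((u⁻¹ : (ZG G)ˣ) : ZG G)
  val_inv := by rw [← involution_mul, Units.inv_mul, involution_one]
  inv_val := by rw [← involution_mul, Units.mul_inv, involution_one]

end BovdiUnits

end

/-!
Write `u = b_k(g, h̃)` and `v = b_l(g, h̃)*`. The proof restricts the left multiplication by `u` and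
`v` to a common invariant plane in `ℂG`, on which both are triangular, and plays ping-pong there.

*The plane.* Put `h' = g h g⁻¹`. Since `g` does not normalize `⟨h⟩`, the group `⟨h'⟩` is a proper
subgroup of the nilpotent group `K = ⟨h, h'⟩`, so it lies in a maximal, hence normal, subgroup of `K`.
The quotient is cyclic, generated by the image of `h`, and has order `p`; so for each `p`-th root
of unity `ζ` there is a character `χ` of `K` with `χ(h') = 1` and `χ(h) = ζ` (`exists_character`).
Let `e = ∑_{x ∈ K} χ(x)⁻¹ x` and `f = g⁻¹ e`. Then `h e = ζ e` and `h f = f`, so that `h̃ e = 0` and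
`h̃ f = p f`. Consequently
`u e = ζ ^ k e`, `u f = f + p (1 - ζ) e`, `v f = f`, `v e = ζ ^ (-l) e + p (1 - ζ⁻¹) f`.

*The estimates.* Choose `ζ ≠ 1` with `|1 - ζ|` maximal. As `|1 - ξ| > 2 / p` for every `p`-th root of
unity `ξ ≠ 1` and `p` is odd, the off-diagonal coefficients of `u` and `u²` (and those of `v` and
`v²`) have absolute value larger than `2`. So for `n = ±1, ±2` the map `u ^ n` sends the vectors
`x e + y f ≠ 0` with `|x| ≤ |y|` to vectors with `|x| > |y|`, and `v ^ n` does the opposite.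

*Ping-pong.* In a reduced word in `uv` and `vu`, no power of `u` or `v` other than the `n`-th ones with
`n = ±1, ±2` appears after multiplying out, so every nontrivial word moves the balanced vector
`e + f` (`injective_lift_mul_mul_swap`).
-/

open Subgroup

/-! ### Ping-pong with a base point -/

/-- Ping-pong for free groups with a base point `z`, which removes the need to control the letters
outside the sets `T`. The set `T a` contains `w • z` for the reduced words `w` starting with `a`. -/
theorem FreeGroup.injective_lift_of_basePoint {ι Γ α : Type*} [Group Γ] [MulAction Γ α]
    (φ : ι → Γ) (T : ι × Bool → Set α) (z : α) (hz : ∀ a, z ∉ T a)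
    (hbase : ∀ a : ι × Bool, (cond a.2 (φ a.1) (φ a.1)⁻¹) • z ∈ T a)
    (hstep : ∀ a b : ι × Bool, (a.1 = b.1 → a.2 = b.2) →
      ∀ m ∈ T b, (cond a.2 (φ a.1) (φ a.1)⁻¹) • m ∈ T a) :
    Function.Injective (FreeGroup.lift φ) := by
  classical
  have key : ∀ (L : List (ι × Bool)) (a : ι × Bool), FreeGroup.IsReduced (a :: L) →
      FreeGroup.lift φ (FreeGroup.mk (a :: L)) • z ∈ T a := by
    intro L
    induction L with
    | nil => intro a _; simpa using hbase a
    | cons b L ih =>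
      intro a ha
      rw [FreeGroup.isReduced_cons_cons] at ha
      have h1 := hstep a b ha.1 _ (ih b ha.2)
      rw [FreeGroup.lift_mk] at h1 ⊢
      rwa [List.map_cons, List.prod_cons, mul_smul]
  rw [injective_iff_map_eq_one]
  intro x hx
  have hred : FreeGroup.IsReduced x.toWord := FreeGroup.isReduced_toWord
  rw [← FreeGroup.toWord_eq_nil_iff]
  cases hL : x.toWord with
  | nil => rfl
  | cons a L =>
    have h1 := key L a (hL ▸ hred)
    rw [← hL, FreeGroup.mk_toWord, hx, one_smul] at h1
    exact absurd h1 (hz a)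

/-- If `u ^ n` and `v ^ n`, for `n = ±1, ±2` only, play ping-pong with a base point, then `uv` and `vu`
are free generators. -/
theorem injective_lift_mul_mul_swap {Γ α : Type*} [Group Γ] [MulAction Γ α]
    (u v : Γ) (X Y : Set α) (z : α) (hzX : z ∉ X) (hzY : z ∉ Y)
    (hu : ∀ w ∈ ({u, u⁻¹, u * u, u⁻¹ * u⁻¹} : Set Γ), ∀ m ∈ insert z Y, w • m ∈ X)
    (hv : ∀ w ∈ ({v, v⁻¹, v * v, v⁻¹ * v⁻¹} : Set Γ), ∀ m ∈ insert z X, w • m ∈ Y) :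
    Function.Injective (FreeGroup.lift ![u * v, v * u]) := by
  have u1 : ∀ m ∈ Y, u • m ∈ X := fun m hm => hu _ (by simp) m (by simp [hm])
  have u2 : ∀ m ∈ Y, u⁻¹ • m ∈ X := fun m hm => hu _ (by simp) m (by simp [hm])
  have u3 : ∀ m ∈ Y, u • u • m ∈ X := fun m hm => by
    rw [← mul_smul]; exact hu _ (by simp) m (by simp [hm])
  have u4 : ∀ m ∈ Y, u⁻¹ • u⁻¹ • m ∈ X := fun m hm => by
    rw [← mul_smul]; exact hu _ (by simp) m (by simp [hm])
  have v1 : ∀ m ∈ X, v • m ∈ Y := fun m hm => hv _ (by simp) m (by simp [hm])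
  have v2 : ∀ m ∈ X, v⁻¹ • m ∈ Y := fun m hm => hv _ (by simp) m (by simp [hm])
  have v3 : ∀ m ∈ X, v • v • m ∈ Y := fun m hm => by
    rw [← mul_smul]; exact hv _ (by simp) m (by simp [hm])
  have v4 : ∀ m ∈ X, v⁻¹ • v⁻¹ • m ∈ Y := fun m hm => by
    rw [← mul_smul]; exact hv _ (by simp) m (by simp [hm])
  have zu : u • z ∈ X := hu _ (by simp) z (by simp)
  have zu' : u⁻¹ • z ∈ X := hu _ (by simp) z (by simp)
  have zv : v • z ∈ Y := hv _ (by simp) z (by simp)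
  have zv' : v⁻¹ • z ∈ Y := hv _ (by simp) z (by simp)
  -- Words starting with `uv`, `vu`, `(uv)⁻¹ = v⁻¹u⁻¹`, `(vu)⁻¹ = u⁻¹v⁻¹` send `z` into
  -- `u • Y`, `v • X`, `v⁻¹ • X`, `u⁻¹ • Y` respectively.
  let T : Fin 2 × Bool → Set α := fun a =>
    if a.1 = 0 then (if a.2 then (u • ·) '' Y else (v⁻¹ • ·) '' X)
    else (if a.2 then (v • ·) '' X else (u⁻¹ • ·) '' Y)
  refine FreeGroup.injective_lift_of_basePoint _ T z ?_ ?_ ?_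
  · rintro ⟨i, b⟩ h
    fin_cases i <;> cases b <;> simp only [T] at h <;>
      obtain ⟨m, hm, rfl⟩ : z ∈ Set.image _ _ := by simpa using h
    · exact hzY (v2 m hm)
    · exact hzX (u1 m hm)
    · exact hzX (u2 m hm)
    · exact hzY (v1 m hm)
  · rintro ⟨i, b⟩
    fin_cases i <;> cases b
    · exact ⟨u⁻¹ • z, zu', by simp [mul_smul]⟩
    · exact ⟨v • z, zv, by simp [mul_smul]⟩
    · exact ⟨v⁻¹ • z, zv', by simp [mul_smul]⟩
    · exact ⟨u • z, zu, by simp [mul_smul]⟩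
  · rintro ⟨i, b⟩ ⟨j, c⟩ hij m hm
    fin_cases i <;> cases b <;> fin_cases j <;> cases c <;> simp at hij <;>
      obtain ⟨m, hm, rfl⟩ : m ∈ Set.image _ _ := hm
    · exact ⟨u⁻¹ • v⁻¹ • m, u2 _ (v2 _ hm), by simp [mul_smul]⟩
    · exact ⟨u⁻¹ • u⁻¹ • m, u4 _ hm, by simp [mul_smul]⟩
    · exact ⟨u⁻¹ • v • m, u2 _ (v1 _ hm), by simp [mul_smul]⟩
    · exact ⟨v • u • m, v1 _ (u1 _ hm), by simp [mul_smul]⟩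
    · exact ⟨v • u⁻¹ • m, v1 _ (u2 _ hm), by simp [mul_smul]⟩
    · exact ⟨v • v • m, v3 _ hm, by simp [mul_smul]⟩
    · exact ⟨v⁻¹ • v⁻¹ • m, v4 _ hm, by simp [mul_smul]⟩
    · exact ⟨v⁻¹ • u • m, v2 _ (u1 _ hm), by simp [mul_smul]⟩
    · exact ⟨v⁻¹ • u⁻¹ • m, v2 _ (u2 _ hm), by simp [mul_smul]⟩
    · exact ⟨u • v⁻¹ • m, u1 _ (v2 _ hm), by simp [mul_smul]⟩
    · exact ⟨u • u • m, u3 _ hm, by simp [mul_smul]⟩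
    · exact ⟨u • v • m, u1 _ (v1 _ hm), by simp [mul_smul]⟩

/-! ### Triangular multiplications on a plane -/

section Triangular

variable {A : Type*} [Ring A] [Algebra ℂ A]

/-- Left multiplication by `a` preserves the plane spanned by `e` and `f` and acts on it by the matrix
with rows `(c, s)` and `(0, d)`, where `|c| = |d| = 1`. -/
structure ActsTriangular (a e f : A) (c d s : ℂ) : Prop where
  mul_left : a * e = c • e
  mul_right : a * f = s • e + d • f
  norm_left : ‖c‖ = 1
  norm_right : ‖d‖ = 1

/-- The vectors of the plane spanned by `e` and `f` whose `e`-coordinate is the larger one. -/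
def dominated (e f : A) : Set A := {m | ∃ x y : ℂ, ‖y‖ < ‖x‖ ∧ m = x • e + y • f}

theorem ActsTriangular.mul_self {a e f : A} {c d s : ℂ} (h : ActsTriangular a e f c d s) :
    ActsTriangular (a * a) e f (c * c) (d * d) ((c + d) * s) where
  mul_left := by rw [mul_assoc, h.mul_left, mul_smul_comm, h.mul_left, smul_smul]
  mul_right := by
    rw [mul_assoc, h.mul_right, mul_add, mul_smul_comm, mul_smul_comm, h.mul_left, h.mul_right]
    module
  norm_left := by rw [norm_mul, h.norm_left, one_mul]
  norm_right := by rw [norm_mul, h.norm_right, one_mul]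

theorem ActsTriangular.inv {u : Aˣ} {e f : A} {c d s : ℂ}
    (h : ActsTriangular (u : A) e f c d s) :
    ActsTriangular ((u⁻¹ : Aˣ) : A) e f c⁻¹ d⁻¹ (-(c⁻¹ * d⁻¹ * s)) := by
  have hc : c ≠ 0 := by intro h0; simpa [h0] using h.norm_left
  have hd : d ≠ 0 := by intro h0; simpa [h0] using h.norm_right
  refine ⟨?_, ?_, by simp [h.norm_left], by simp [h.norm_right]⟩
  · rw [Units.inv_mul_eq_iff_eq_mul, mul_smul_comm, h.mul_left, smul_smul, inv_mul_cancel₀ hc,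
      one_smul]
  · rw [Units.inv_mul_eq_iff_eq_mul, mul_add, mul_smul_comm, mul_smul_comm, h.mul_left,
      h.mul_right, smul_add, smul_smul, smul_smul, smul_smul, inv_mul_cancel₀ hd, one_smul,
      ← add_assoc, ← add_smul]
    have : -(c⁻¹ * d⁻¹ * s) * c + d⁻¹ * s = 0 := by field_simp; ring
    rw [this, zero_smul, zero_add]

theorem ActsTriangular.mul_mem_dominated {a e f : A} {c d s : ℂ} (h : ActsTriangular a e f c d s)
    (hs : 2 < ‖s‖) {x y : ℂ} (hxy : ‖x‖ ≤ ‖y‖) (hy : y ≠ 0) :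
    a * (x • e + y • f) ∈ dominated e f := by
  refine ⟨x * c + y * s, y * d, ?_, ?_⟩
  · have h0 : 0 < ‖y‖ := norm_pos_iff.mpr hy
    have h1 : ‖y * s‖ ≤ ‖x * c + y * s‖ + ‖x * c‖ := by
      simpa using norm_sub_le (x * c + y * s) (x * c)
    rw [norm_mul, norm_mul, h.norm_left, mul_one] at h1
    rw [norm_mul, h.norm_right, mul_one]
    nlinarith
  · rw [mul_add, mul_smul_comm, mul_smul_comm, h.mul_left, h.mul_right]
    module

/-- One half of the ping-pong: the powers of `u` with exponent `±1`, `±2` send the vectors of the plane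
with `|x| ≤ |y|` to vectors with `|x| > |y|`. -/
theorem ActsTriangular.smul_mem_dominated {u : Aˣ} {e f : A} {c d s : ℂ}
    (h : ActsTriangular (u : A) e f c d s) (hs : 2 < ‖s‖) (hcd : 2 < ‖c + d‖ * ‖s‖) :
    ∀ w ∈ ({u, u⁻¹, u * u, u⁻¹ * u⁻¹} : Set Aˣ),
      ∀ m ∈ insert (f + e) (dominated f e), w • m ∈ dominated e f := by
  have hc : c ≠ 0 := by intro h0; simpa [h0] using h.norm_left
  have hd : d ≠ 0 := by intro h0; simpa [h0] using h.norm_right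
  have hinv : ‖c⁻¹ + d⁻¹‖ = ‖c + d‖ := by
    rw [inv_add_inv hc hd, norm_div, norm_mul, h.norm_left, h.norm_right]
    simp
  have hs' : ‖-(c⁻¹ * d⁻¹ * s)‖ = ‖s‖ := by
    rw [norm_neg, norm_mul, norm_mul, norm_inv, norm_inv, h.norm_left, h.norm_right]
    simp
  intro w hw m hm
  obtain ⟨x, y, hxy, hy, rfl⟩ : ∃ x y : ℂ, ‖x‖ ≤ ‖y‖ ∧ y ≠ 0 ∧ m = x • e + y • f := by
    rcases hm with rfl | ⟨y, x, hxy, rfl⟩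
    · exact ⟨1, 1, le_rfl, one_ne_zero, by simp [add_comm]⟩
    · exact ⟨x, y, hxy.le, norm_pos_iff.mp ((norm_nonneg x).trans_lt hxy), add_comm _ _⟩
  rw [Units.smul_def, smul_eq_mul]
  rcases hw with rfl | rfl | rfl | rfl
  · exact h.mul_mem_dominated hs hxy hy
  · exact h.inv.mul_mem_dominated (by rwa [hs']) hxy hy
  · rw [Units.val_mul]
    exact h.mul_self.mul_mem_dominated (by rwa [norm_mul]) hxy hy
  · rw [Units.val_mul]
    exact h.inv.mul_self.mul_mem_dominated (by rwa [norm_mul, hs', hinv]) hxy hy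

theorem add_notMem_dominated {e f : A} (hef : LinearIndependent ℂ ![e, f]) :
    e + f ∉ dominated e f := by
  rintro ⟨x, y, hxy, h⟩
  rw [LinearIndependent.pair_iff] at hef
  obtain ⟨hx, hy⟩ := hef (x - 1) (y - 1) (by
    rw [sub_smul, sub_smul, one_smul, one_smul, sub_add_sub_comm, ← h, sub_self])
  rw [sub_eq_zero.mp hx, sub_eq_zero.mp hy] at hxy
  exact lt_irrefl _ hxy

/-- Two units, one acting by an upper and one by a lower triangular matrix on the same plane, with
large off-diagonal coefficients in their first and second powers. -/
theorem injective_lift_of_actsTriangular {u v : Aˣ} {e f : A} {c d s c' d' s' : ℂ}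
    (hef : LinearIndependent ℂ ![e, f])
    (hu : ActsTriangular (u : A) e f c d s) (hs : 2 < ‖s‖) (hcd : 2 < ‖c + d‖ * ‖s‖)
    (hv : ActsTriangular (v : A) f e c' d' s') (hs' : 2 < ‖s'‖)
    (hcd' : 2 < ‖c' + d'‖ * ‖s'‖) :
    Function.Injective (FreeGroup.lift ![u * v, v * u]) := by
  refine injective_lift_mul_mul_swap u v (dominated e f) (dominated f e) (e + f)
    (add_notMem_dominated hef) ?_ ?_ (hv.smul_mem_dominated hs' hcd')
  · rw [add_comm]
    exact add_notMem_dominated (LinearIndependent.pair_symm_iff.mp hef)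
  · rw [add_comm]
    exact hu.smul_mem_dominated hs hcd

end Triangular

/-! ### Estimates for roots of unity -/

theorem norm_one_sub_pow_le {ξ : ℂ} (hξ : ‖ξ‖ = 1) (j : ℕ) : ‖1 - ξ ^ j‖ ≤ j * ‖1 - ξ‖ := by
  rw [← mul_neg_geom_sum, norm_mul, mul_comm]
  gcongr
  refine (norm_sum_le _ _).trans ?_
  simp [hξ]

/-- The bound comes from `n = ∑_{j < n} (1 - ξ ^ j)` and `|1 - ξ ^ j| ≤ j |1 - ξ|`. -/
theorem two_lt_mul_norm_one_sub {n : ℕ} (hn : 0 < n) {ξ : ℂ} (hξ : ξ ^ n = 1) (hξ1 : ξ ≠ 1) :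
    2 < n * ‖1 - ξ‖ := by
  have hnorm : ‖ξ‖ = 1 := Complex.norm_eq_one_of_pow_eq_one hξ hn.ne'
  have hn' : (0 : ℝ) < n := by exact_mod_cast hn
  have hgeom : ∑ j ∈ Finset.range n, ξ ^ j = 0 := by
    have h := mul_neg_geom_sum ξ n
    rw [hξ, sub_self] at h
    exact (mul_eq_zero.mp h).resolve_left (sub_ne_zero.mpr hξ1.symm)
  have hsum : (n : ℂ) = ∑ j ∈ Finset.range n, (1 - ξ ^ j) := by
    rw [Finset.sum_sub_distrib, hgeom]; simp
  have h1 : (n : ℝ) ≤ ∑ j ∈ Finset.range n, (j : ℝ) * ‖1 - ξ‖ := by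
    calc (n : ℝ) = ‖(n : ℂ)‖ := by simp
      _ ≤ ∑ j ∈ Finset.range n, ‖1 - ξ ^ j‖ := by rw [hsum]; exact norm_sum_le _ _
      _ ≤ _ := Finset.sum_le_sum fun j _ => norm_one_sub_pow_le hnorm j
  have h2 : (∑ j ∈ Finset.range n, (j : ℝ)) * 2 = n * (n - 1) := by
    have := Finset.sum_range_id_mul_two n
    rw [← Nat.cast_pred hn, ← Nat.cast_sum, ← Nat.cast_mul, ← this]
    simp
  have hpos : 0 < ‖1 - ξ‖ := norm_pos_iff.mpr (sub_ne_zero.mpr hξ1.symm)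
  rw [← Finset.sum_mul] at h1
  have h3 : (n : ℝ) * 2 ≤ n * ((n - 1) * ‖1 - ξ‖) := by
    calc (n : ℝ) * 2 ≤ (∑ j ∈ Finset.range n, (j : ℝ)) * ‖1 - ξ‖ * 2 := by linarith
      _ = n * ((n - 1) * ‖1 - ξ‖) := by rw [mul_right_comm, h2]; ring
  have h4 := le_of_mul_le_mul_left h3 hn'
  linarith

theorem exists_rootOfUnity_norm_one_sub_max {n : ℕ} (hn : 1 < n) :
    ∃ ζ : ℂ, ζ ^ n = 1 ∧ ζ ≠ 1 ∧ ∀ ξ : ℂ, ξ ^ n = 1 → ‖1 - ξ‖ ≤ ‖1 - ζ‖ := by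
  have hn0 : 0 < n := by lia
  obtain ⟨ζ, hζ, hmax⟩ := Finset.exists_max_image (Polynomial.nthRootsFinset n (1 : ℂ))
    (fun ξ => ‖1 - ξ‖) ⟨1, by simp [Polynomial.mem_nthRootsFinset hn0]⟩
  simp only [Polynomial.mem_nthRootsFinset hn0] at hζ hmax
  refine ⟨ζ, hζ, ?_, hmax⟩
  rintro rfl
  have hprim := Complex.isPrimitiveRoot_exp n hn0.ne'
  have h := hmax _ hprim.pow_eq_one
  rw [sub_self, norm_zero, norm_le_zero_iff, sub_eq_zero] at h
  exact hprim.ne_one hn h.symm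

/-- For odd `n`, the factor `1 + ζ ^ k` does not spoil the lower bound: it is either `2`, or the
quotient of `1 - ζ ^ (2 k)` by a number that is not larger than `1 - ζ`. -/
theorem two_lt_norm_one_add_pow_mul {n : ℕ} (hn : 0 < n) (hodd : Odd n) {ζ : ℂ} (hζ : ζ ^ n = 1)
    (hζ1 : ζ ≠ 1) (hmax : ∀ ξ : ℂ, ξ ^ n = 1 → ‖1 - ξ‖ ≤ ‖1 - ζ‖) (k : ℕ) :
    2 < ‖1 + ζ ^ k‖ * (n * ‖1 - ζ‖) := by
  have hk : (ζ ^ k) ^ n = 1 := by rw [← pow_mul, mul_comm, pow_mul, hζ, one_pow]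
  by_cases h1 : ζ ^ k = 1
  · have := two_lt_mul_norm_one_sub hn hζ hζ1
    rw [h1]
    norm_num
    linarith
  · have h2 : (ζ ^ k) ^ 2 ≠ 1 := by
      intro h2
      obtain ⟨m, hm⟩ := hodd
      rw [hm, pow_succ, pow_mul, h2, one_pow, one_mul] at hk
      exact h1 hk
    have h3 := two_lt_mul_norm_one_sub hn (ξ := (ζ ^ k) ^ 2)
      (by rw [← pow_mul, mul_comm, pow_mul, hk, one_pow]) h2
    calc (2 : ℝ) < n * ‖1 - (ζ ^ k) ^ 2‖ := h3
      _ = ‖1 + ζ ^ k‖ * (n * ‖1 - ζ ^ k‖) := by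
        rw [show 1 - (ζ ^ k) ^ 2 = (1 + ζ ^ k) * (1 - ζ ^ k) by ring, norm_mul]; ring
      _ ≤ _ := by gcongr; exact hmax _ hk

/-! ### A character of a nilpotent group generated by two elements -/

/-- In a finite nilpotent group generated by `a` and `b`, with `a ∉ ⟨b⟩` of prime order, there is a
normal complement to `⟨a⟩` containing `b`, so the value at `a` of a character trivial on `b` can be
prescribed. -/
theorem exists_character {K : Type*} [Group K] [Finite K] [Group.IsNilpotent K] {a b : K} {p : ℕ}
    (hp : p.Prime) (ha : orderOf a = p) (hab : a ∉ zpowers b)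
    (hgen : closure {a, b} = (⊤ : Subgroup K)) (ζ : ℂˣ) (hζ : ζ ^ p = 1) :
    ∃ χ : K →* ℂˣ, χ a = ζ ∧ χ b = 1 := by
  obtain ⟨M, hM, hbM⟩ : ∃ M : Subgroup K, IsCoatom M ∧ zpowers b ≤ M :=
    (eq_top_or_exists_le_coatom (zpowers b)).resolve_left fun h => hab (h ▸ mem_top a)
  have hnorm : M.Normal :=
    NormalizerCondition.normal_of_coatom _ Group.normalizerCondition_of_isNilpotent hM
  have hb : b ∈ M := hbM (mem_zpowers b)
  have haM : a ∉ M := fun h => hM.1 <| by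
    rw [eq_top_iff, ← hgen, closure_le]
    rintro x (rfl | rfl) <;> assumption
  have hord : orderOf (a : K ⧸ M) = p := by
    have : Fact p.Prime := ⟨hp⟩
    refine orderOf_eq_prime ?_ ?_
    · rw [← QuotientGroup.mk_pow, ← ha, pow_orderOf_eq_one, QuotientGroup.mk_one]
    · rwa [Ne, QuotientGroup.eq_one_iff]
  have hcyc : ∀ x : K ⧸ M, x ∈ zpowers (a : K ⧸ M) := by
    intro x
    induction x using QuotientGroup.induction_on with
    | H x =>
      have hle : (⊤ : Subgroup K) ≤ (zpowers (a : K ⧸ M)).comap (QuotientGroup.mk' M) := by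
        rw [← hgen, closure_le]
        rintro y (rfl | rfl)
        · exact mem_zpowers _
        · have : ((y : K) : K ⧸ M) = 1 := (QuotientGroup.eq_one_iff y).mpr hb
          simp [this]
      exact hle (mem_top x)
  have hdvd : orderOf ζ ∣ orderOf (a : K ⧸ M) := hord ▸ orderOf_dvd_of_pow_eq_one hζ
  refine ⟨(monoidHomOfForallMemZpowers hcyc hdvd).comp (QuotientGroup.mk' M), ?_, ?_⟩
  · exact monoidHomOfForallMemZpowers_apply_gen hcyc hdvd
  · rw [MonoidHom.comp_apply, QuotientGroup.mk'_apply, (QuotientGroup.eq_one_iff b).mpr hb, map_one]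

theorem notMem_zpowers_conj_of_notMem_normalizer {G : Type*} [Group G] [Finite G] {g h : G}
    (hg : g ∉ normalizer (zpowers h : Set G)) : h ∉ zpowers (g * h * g⁻¹) := by
  intro hmem
  apply hg
  rw [mem_normalizer_iff_map_conj_eq]
  have h1 : (zpowers h).map (MulAut.conj g).toMonoidHom = zpowers (g * h * g⁻¹) := by
    rw [MonoidHom.map_zpowers]; simp
  refine (Subgroup.eq_of_le_of_card_ge ?_ ?_).symm
  · exact (zpowers_le.mpr hmem).trans h1.ge
  · exact (Subgroup.card_map_of_injective (MulAut.conj g).injective).le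

theorem exists_character_closure_conj {G : Type*} [Group G] [Finite G] [Group.IsNilpotent G]
    {g h : G} (hg : g ∉ normalizer (zpowers h : Set G)) {p : ℕ} (hp : p.Prime)
    (ho : orderOf h = p) (ζ : ℂˣ) (hζ : ζ ^ p = 1) :
    ∃ (K : Subgroup G) (χ : K →* ℂˣ) (hh : h ∈ K) (hh' : g * h * g⁻¹ ∈ K),
      χ ⟨h, hh⟩ = ζ ∧ χ ⟨g * h * g⁻¹, hh'⟩ = 1 := by
  have hh : h ∈ closure {h, g * h * g⁻¹} := subset_closure (by simp)
  have hh' : g * h * g⁻¹ ∈ closure {h, g * h * g⁻¹} := subset_closure (by simp)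
  obtain ⟨χ, hχ⟩ := exists_character (K := closure {h, g * h * g⁻¹}) (a := ⟨h, hh⟩)
    (b := ⟨g * h * g⁻¹, hh'⟩) hp (by rwa [Subgroup.orderOf_mk]) (by
      rintro ⟨n, hn⟩
      exact notMem_zpowers_conj_of_notMem_normalizer hg ⟨n, by simpa using congrArg Subtype.val hn⟩)
    (by
      convert closure_closure_coe_preimage (k := {h, g * h * g⁻¹}) using 2
      ext x
      simp [Subtype.ext_iff]) ζ hζ
  exact ⟨_, χ, hh, hh', hχ⟩

/-! ### The eigenvector of a character in the complex group algebra -/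

section Eigenvector

variable {G : Type*} [Group G] [Finite G] {K : Subgroup G}

/-- The element `∑_{x ∈ K} χ(x)⁻¹ x` of `ℂG`. -/
noncomputable def charSum (χ : K →* ℂˣ) : MonoidAlgebra ℂ G :=
  ∑ᶠ x : K, MonoidAlgebra.single (x : G) ((χ x)⁻¹ : ℂˣ).val

theorem single_mul_charSum (χ : K →* ℂˣ) (y : K) :
    MonoidAlgebra.single (y : G) (1 : ℂ) * charSum χ = (χ y : ℂ) • charSum χ := by
  have := Fintype.ofFinite K
  rw [charSum, finsum_eq_sum_of_fintype, Finset.mul_sum, Finset.smul_sum]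
  refine Fintype.sum_equiv (Equiv.mulLeft y) _ _ fun x => ?_
  rw [MonoidAlgebra.single_mul_single, MonoidAlgebra.smul_single, one_mul, Equiv.coe_mulLeft,
    Subgroup.coe_mul, map_mul, mul_inv, smul_eq_mul, Units.val_mul, Units.mul_inv_cancel_left]

theorem charSum_ne_zero (χ : K →* ℂˣ) : charSum χ ≠ 0 := by
  classical
  have := Fintype.ofFinite K
  intro h
  have h1 : (charSum χ).coeff 1 = 1 := by
    rw [charSum, finsum_eq_sum_of_fintype, MonoidAlgebra.coeff_sum, Finsupp.finsetSum_apply,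
      Finset.sum_eq_single 1]
    · simp
    · intro x _ hx
      simp [hx]
    · simp
  simp [h] at h1

end Eigenvector

/-! ### The action of the Bovdi units -/

namespace BovdiUnits

/-- The inclusion of `ℤG` into `ℂG`. -/
noncomputable abbrev toComplex (G : Type*) [Group G] : ZG G →+* MonoidAlgebra ℂ G :=
  MonoidAlgebra.mapRingHom G (Int.castRingHom ℂ)

variable {G : Type*} [Group G]

theorem toComplex_elt (x : G) : toComplex G (elt x) = MonoidAlgebra.single x 1 := by
  simp [toComplex]

variable {h : G} {m : MonoidAlgebra ℂ G} {c : ℂ}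

theorem elt_pow_mul_of_eigenvector (hm : toComplex G (elt h) * m = c • m) (j : ℕ) :
    toComplex G (elt (h ^ j)) * m = c ^ j • m := by
  rw [elt, map_pow, map_pow]
  induction j with
  | zero => simp
  | succ j ih => rw [pow_succ, mul_assoc, hm, mul_smul_comm, ih, smul_smul, pow_succ, mul_comm]

theorem elt_inv_mul_of_eigenvector (hc : c ≠ 0) (hm : toComplex G (elt h) * m = c • m) :
    toComplex G (elt h⁻¹) * m = c⁻¹ • m := by
  rw [toComplex_elt] at hm ⊢
  have h1 : MonoidAlgebra.single h⁻¹ (1 : ℂ) * (MonoidAlgebra.single h 1 * m) = m := by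
    rw [← mul_assoc, MonoidAlgebra.single_mul_single, inv_mul_cancel, one_mul,
      ← MonoidAlgebra.one_def, one_mul]
  rw [hm, mul_smul_comm] at h1
  rw [eq_inv_smul_iff₀ hc, h1]

variable [Finite G]

theorem tilde_eq_sum_range (h : G) : tilde h = ∑ j ∈ Finset.range (orderOf h), elt (h ^ j) := by
  classical
  rw [tilde, tildeSet]
  have : (Subgroup.zpowers h : Set G).toFinite.toFinset =
      (Finset.range (orderOf h)).image (h ^ ·) := by
    ext x
    simp [mem_zpowers_iff_mem_range_orderOf]
  rw [this, Finset.sum_image]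
  exact fun i hi j hj hij => pow_injOn_Iio_orderOf (by simpa using hi) (by simpa using hj) hij

theorem involution_tilde (h : G) : involution (tilde h) = tilde h := by
  rw [tilde, tildeSet, map_sum]
  refine Finset.sum_bij' (fun x _ => x⁻¹) (fun x _ => x⁻¹) ?_ ?_ ?_ ?_ ?_ <;>
    simp [involution]

theorem involution_bovdiUnit (k : ℕ) (g h : G) :
    involution (bovdiUnit k g h : ZG G) =
      elt (h ^ k)⁻¹ + tilde h * (elt g⁻¹ * (1 - elt h⁻¹)) := by
  rw [bovdiUnit, map_add, involution_elt, involution_mul, involution_mul, involution_tilde,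
    map_sub, involution_one, involution_elt, involution_elt]

theorem tilde_mul_of_eigenvector (hm : toComplex G (elt h) * m = c • m) :
    toComplex G (tilde h) * m = (∑ j ∈ Finset.range (orderOf h), c ^ j) • m := by
  rw [tilde_eq_sum_range, map_sum, Finset.sum_mul, Finset.sum_smul]
  exact Finset.sum_congr rfl fun j _ => elt_pow_mul_of_eigenvector hm j

variable {g : G} {e f : MonoidAlgebra ℂ G}

/-- If `e = g f`, `h e = ζ e` and `h f = f`, then `b_k(g, h̃)` is upper triangular on the plane spanned
by `e` and `f`. -/
theorem actsTriangular_bovdiUnit {ζ : ℂ} (hζ : ζ ^ orderOf h = 1) (hζ1 : ζ ≠ 1)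
    (he : toComplex G (elt h) * e = ζ • e) (hf : toComplex G (elt h) * f = f)
    (hgf : toComplex G (elt g) * f = e) (k : ℕ) :
    ActsTriangular (toComplex G (bovdiUnit k g h)) e f (ζ ^ k) 1 (orderOf h * (1 - ζ)) := by
  have hf1 : toComplex G (elt h) * f = (1 : ℂ) • f := by rw [hf, one_smul]
  have hte : toComplex G (tilde h) * e = 0 := by
    rw [tilde_mul_of_eigenvector he]
    have h1 := mul_neg_geom_sum ζ (orderOf h)
    rw [hζ, sub_self] at h1
    rw [(mul_eq_zero.mp h1).resolve_left (sub_ne_zero.mpr hζ1.symm), zero_smul]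
  have htf : toComplex G (tilde h) * f = (orderOf h : ℂ) • f := by
    rw [tilde_mul_of_eigenvector hf1]; simp
  have hval : (bovdiUnit k g h : ZG G) = elt (h ^ k) + (1 - elt h) * elt g * tilde h := rfl
  refine ⟨?_, ?_, ?_, by simp⟩
  · rw [hval, map_add, map_mul, add_mul, mul_assoc _ _ e, hte, elt_pow_mul_of_eigenvector he]
    simp
  · rw [hval, map_add, map_mul, map_mul, map_sub, map_one, add_mul, mul_assoc _ _ f, htf,
      elt_pow_mul_of_eigenvector hf1, mul_smul_comm, mul_assoc, hgf, sub_mul, he]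
    rw [one_mul, one_pow]
    module
  · rw [norm_pow, Complex.norm_eq_one_of_pow_eq_one hζ (orderOf_pos h).ne', one_pow]

/-- Under the same hypotheses `b_l(g, h̃)*` is lower triangular on the plane spanned by `e` and `f`. -/
theorem actsTriangular_unitStar_bovdiUnit {ζ : ℂ} (hζ : ζ ^ orderOf h = 1)
    (he : toComplex G (elt h) * e = ζ • e) (hf : toComplex G (elt h) * f = f)
    (hge : toComplex G (elt g⁻¹) * e = f) (l : ℕ) :
    ActsTriangular (toComplex G (unitStar (bovdiUnit l g h))) f e 1 (ζ ^ l)⁻¹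
      (orderOf h * (1 - ζ⁻¹)) := by
  have hζ0 : ζ ≠ 0 := by
    rintro rfl
    simp [(orderOf_pos h).ne'] at hζ
  have hf1 : toComplex G (elt h) * f = (1 : ℂ) • f := by rw [hf, one_smul]
  have htf : toComplex G (tilde h) * f = (orderOf h : ℂ) • f := by
    rw [tilde_mul_of_eigenvector hf1]; simp
  have hval : (unitStar (bovdiUnit l g h) : ZG G) =
      elt (h ^ l)⁻¹ + tilde h * (elt g⁻¹ * (1 - elt h⁻¹)) := involution_bovdiUnit l g h
  refine ⟨?_, ?_, by simp, ?_⟩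
  · have h1 : toComplex G (elt (h ^ l)⁻¹) * f = (1 : ℂ)⁻¹ • f :=
      elt_inv_mul_of_eigenvector one_ne_zero (by simpa using elt_pow_mul_of_eigenvector hf1 l)
    have h2 : toComplex G (elt h⁻¹) * f = (1 : ℂ)⁻¹ • f :=
      elt_inv_mul_of_eigenvector one_ne_zero hf1
    rw [hval, map_add, map_mul, map_mul, map_sub, map_one, add_mul, h1, mul_assoc, mul_assoc,
      sub_mul, h2]
    simp
  · have h1 : toComplex G (elt (h ^ l)⁻¹) * e = (ζ ^ l)⁻¹ • e :=
      elt_inv_mul_of_eigenvector (pow_ne_zero l hζ0) (elt_pow_mul_of_eigenvector he l)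
    have h2 : toComplex G (elt h⁻¹) * e = ζ⁻¹ • e := elt_inv_mul_of_eigenvector hζ0 he
    rw [hval, map_add, map_mul, map_mul, map_sub, map_one, add_mul, h1, mul_assoc, mul_assoc,
      sub_mul, h2, one_mul, mul_sub, mul_smul_comm, hge, mul_sub, mul_smul_comm, htf]
    module
  · rw [norm_inv, norm_pow, Complex.norm_eq_one_of_pow_eq_one hζ (orderOf_pos h).ne', one_pow,
      inv_one]

end BovdiUnits

open BovdiUnits in
theorem injective_lift_bovdiUnit {G : Type*} [Group G] [Finite G] [Group.IsNilpotent G] {g h : G}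
    (hg : g ∉ normalizer (zpowers h : Set G)) {p : ℕ} (hp : p.Prime) (hp2 : p ≠ 2)
    (ho : orderOf h = p) (k l : ℕ) :
    Function.Injective (FreeGroup.lift
      ![bovdiUnit k g h * unitStar (bovdiUnit l g h),
        unitStar (bovdiUnit l g h) * bovdiUnit k g h]) := by
  obtain ⟨ζ, hζ, hζ1, hmax⟩ := exists_rootOfUnity_norm_one_sub_max hp.one_lt
  have hodd : Odd p := hp.odd_of_ne_two hp2
  have hnorm : ‖ζ‖ = 1 := Complex.norm_eq_one_of_pow_eq_one hζ hp.ne_zero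
  have hζ0 : ζ ≠ 0 := by rintro rfl; simp at hnorm
  obtain ⟨K, χ, hh, hh', hχ, hχ'⟩ := exists_character_closure_conj hg hp ho (Units.mk0 ζ hζ0)
    (by ext; simpa using hζ)
  let e := charSum χ
  let f := toComplex G (elt g⁻¹) * e
  have he : toComplex G (elt h) * e = ζ • e := by
    rw [toComplex_elt, single_mul_charSum χ ⟨h, hh⟩, hχ, Units.val_mk0]
  have he' : toComplex G (elt (g * h * g⁻¹)) * e = e := by
    rw [toComplex_elt, single_mul_charSum χ ⟨g * h * g⁻¹, hh'⟩, hχ', Units.val_one, one_smul]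
  have hf : toComplex G (elt h) * f = f := by
    calc toComplex G (elt h) * f
        = toComplex G (elt g⁻¹) * (toComplex G (elt (g * h * g⁻¹)) * e) := by
          simp only [f]
          rw [← mul_assoc, ← mul_assoc, ← map_mul, ← map_mul, ← map_mul, ← map_mul,
            show h * g⁻¹ = g⁻¹ * (g * h * g⁻¹) by group]
      _ = f := by rw [he']
  have hgf : toComplex G (elt g) * f = e := by
    simp only [f]
    rw [← mul_assoc, ← map_mul, elt, elt, ← map_mul, mul_inv_cancel, map_one, map_one, one_mul]
  have he0 : e ≠ 0 := charSum_ne_zero χ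
  have hf0 : f ≠ 0 := by
    intro h0
    rw [h0, mul_zero] at hgf
    exact he0 hgf.symm
  have hef : LinearIndependent ℂ ![e, f] := by
    rw [LinearIndependent.pair_iff]
    intro x y hxy
    -- Multiplication by `1 - h` kills `f` and multiplies `e` by `1 - ζ ≠ 0`.
    have h1 : (x * (1 - ζ)) • e = 0 := by
      calc (x * (1 - ζ)) • e
          = (x • e + y • f) - toComplex G (elt h) * (x • e + y • f) := by
            rw [mul_add, mul_smul_comm, mul_smul_comm, he, hf]; module
        _ = 0 := by rw [hxy, mul_zero, sub_zero]
    have hx : x = 0 := by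
      have h2 := (smul_eq_zero.mp h1).resolve_right he0
      exact (mul_eq_zero.mp h2).resolve_right (sub_ne_zero.mpr hζ1.symm)
    rw [hx, zero_smul, zero_add] at hxy
    exact ⟨hx, (smul_eq_zero.mp hxy).resolve_right hf0⟩
  have hbound := two_lt_mul_norm_one_sub hp.pos hζ hζ1
  have hs : ‖(p : ℂ) * (1 - ζ)‖ = p * ‖1 - ζ‖ := by simp
  have hs' : ‖(p : ℂ) * (1 - ζ⁻¹)‖ = p * ‖1 - ζ‖ := by
    rw [norm_mul, show 1 - ζ⁻¹ = -(ζ⁻¹ * (1 - ζ)) by field_simp; ring, norm_neg, norm_mul,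
      norm_inv, hnorm]
    simp
  have hl : ‖1 + (ζ ^ l)⁻¹‖ = ‖1 + ζ ^ l‖ := by
    have : (1 + (ζ ^ l)⁻¹) = (ζ ^ l)⁻¹ * (1 + ζ ^ l) := by
      rw [mul_add, mul_one, inv_mul_cancel₀ (pow_ne_zero l hζ0), add_comm]
    rw [this, norm_mul, norm_inv, norm_pow, hnorm]
    simp
  have hu := actsTriangular_bovdiUnit (ho ▸ hζ) hζ1 he hf hgf k
  have hv := actsTriangular_unitStar_bovdiUnit (ho ▸ hζ) he hf rfl l
  rw [ho] at hu hv
  let ρ : (ZG G)ˣ →* (MonoidAlgebra ℂ G)ˣ := Units.map (toComplex G).toMonoidHom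
  have hinj := injective_lift_of_actsTriangular (u := ρ (bovdiUnit k g h))
    (v := ρ (unitStar (bovdiUnit l g h))) hef hu (by rwa [hs])
    (by rw [hs, add_comm]; exact two_lt_norm_one_add_pow_mul hp.pos hodd hζ hζ1 hmax k)
    hv (by rwa [hs']) (by rw [hs', hl]; exact two_lt_norm_one_add_pow_mul hp.pos hodd hζ hζ1 hmax l)
  have hcomp : ρ.comp (FreeGroup.lift ![bovdiUnit k g h * unitStar (bovdiUnit l g h),
      unitStar (bovdiUnit l g h) * bovdiUnit k g h]) =
      FreeGroup.lift ![ρ (bovdiUnit k g h) * ρ (unitStar (bovdiUnit l g h)),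
        ρ (unitStar (bovdiUnit l g h)) * ρ (bovdiUnit k g h)] := by
    ext i : 1
    fin_cases i <;> simp
  rw [← hcomp] at hinj
  exact Function.Injective.of_comp (f := ρ) hinj

theorem mainTheorem5 {G : Type*} [Group G] [Finite G] [Group.IsNilpotent G] (g h : G)
    (hg : g ∉ Subgroup.normalizer (Subgroup.zpowers h : Set G))
    (p : ℕ) (hp : p.Prime) (hp2 : p ≠ 2) (ho : orderOf h = p)
    (k l : ℕ) (hk : 1 ≤ k) (hl : 1 ≤ l) :
    Nonempty (FreeGroup (Fin 2) ≃*
      Subgroup.closure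
        ({BovdiUnits.bovdiUnit k g h * BovdiUnits.unitStar (BovdiUnits.bovdiUnit l g h),
          BovdiUnits.unitStar (BovdiUnits.bovdiUnit l g h) * BovdiUnits.bovdiUnit k g h} :
          Set (MonoidAlgebra ℤ G)ˣ)) := by
  have hinj := injective_lift_bovdiUnit hg hp hp2 ho k l
  refine ⟨(MonoidHom.ofInjective hinj).trans (MulEquiv.subgroupCongr ?_)⟩
  rw [FreeGroup.range_lift_eq_closure, Matrix.range_cons, Matrix.range_cons, Matrix.range_empty,
    Set.union_empty, Set.singleton_union]
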